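/- On $L^2(\mathbb R^2)$ with variables $(x,y)$ put $D_x=-i\partial_x$, $D_y=-i\partial_y$, and let $H_0=(D_x+y)^2+D_y^2+x$, understood as the closure in $L^2(\mathbb R^2)$ of this differential operator on $C_0^\infty(\mathbb R^2)$ (this is a self-adjoint operator). Let $x$, $D_x+y$ and $D_y$ also denote the operators in $L^2(\mathbb R^2)$ with their natural domains (all $f\in L^2(\mathbb R^2)$ for which $xf$, respectively $(D_x+y)f$, $D_yf$ taken in the sense of distributions, lies in $L^2(\mathbb R^2)$), and give powers and products of operators their natural domains. Then each of the five operators $$x(H_0-i)^{-1},\qquad (D_x+y)^k(H_0-i)^{-1},\qquad D_y^k(H_0-i)^{-1},\qquad k=1,2,$$ is unbounded from $L^2(\mathbb R^2)$ into $L^2(\mathbb R^2)$: for none of these operators $T$ is there a constant $C$ such that $\|Tu\|\le C\|u\|$ for all $u$ in the domain of $T$. -/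

import Mathlib

open scoped ContDiff InnerProductSpace
open MeasureTheory

namespace LandauStark

noncomputable section

/-- The Hilbert space `L²(ℝ²)` of complex-valued functions; points of `ℝ²` are pairs `(x, y)` and
the measure is Lebesgue measure. -/
abbrev L2 : Type := Lp ℂ 2 (volume : Measure (ℝ × ℝ))

/-- The space `C₀^∞(ℝ²)` of smooth compactly supported complex-valued functions. -/
def testFunctions : Submodule ℂ (ℝ × ℝ → ℂ) where
  carrier := {φ | ContDiff ℝ ∞ φ ∧ HasCompactSupport φ}
  zero_mem' := ⟨contDiff_const, HasCompactSupport.zero⟩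
  add_mem' ha hb := ⟨ha.1.add hb.1, ha.2.add hb.2⟩
  smul_mem' c _ ha := ⟨contDiff_const.smul ha.1, ha.2.smul_left (f := fun _ => c)⟩

/-- The derivative `D_v φ = -i ∂_v φ` of a test function in the direction `v`. -/
def dirD (v : ℝ × ℝ) : Module.End ℂ testFunctions where
  toFun φ := ⟨fun p => -Complex.I * fderiv ℝ (φ : ℝ × ℝ → ℂ) p v,
    contDiff_const.mul ((φ.2.1.fderiv_right (m := ∞) (by simp)).clm_apply contDiff_const),
    ((φ.2.2.fderiv_apply (𝕜 := ℝ) v)).mul_left⟩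
  map_add' φ ψ := by
    ext p
    have h1 := (φ.2.1.differentiable (by simp)) p
    have h2 := (ψ.2.1.differentiable (by simp)) p
    simp [fderiv_add h1 h2, mul_add]
  map_smul' c φ := by
    ext p
    have h1 := (φ.2.1.differentiable (by simp)) p
    simp [fderiv_const_smul h1 c]
    ring

/-- `D_x = -i ∂_x` on test functions. -/
def Dx : Module.End ℂ testFunctions := dirD (1, 0)

/-- `D_y = -i ∂_y` on test functions. -/
def Dy : Module.End ℂ testFunctions := dirD (0, 1)

/-- Multiplication of test functions by a real linear function `ℓ` on `ℝ²`. -/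
def mulLin (l : ℝ × ℝ →L[ℝ] ℝ) : Module.End ℂ testFunctions where
  toFun φ := ⟨fun p => (l p : ℂ) * (φ : ℝ × ℝ → ℂ) p,
    (Complex.ofRealCLM.contDiff.comp l.contDiff).mul φ.2.1, φ.2.2.mul_left⟩
  map_add' φ ψ := by
    ext p
    simp [mul_add]
  map_smul' c φ := by
    ext p
    simp
    ring

/-- Multiplication by the coordinate `x` on test functions. -/
def Mx : Module.End ℂ testFunctions := mulLin (ContinuousLinearMap.fst ℝ ℝ ℝ)

/-- Multiplication by the coordinate `y` on test functions. -/
def My : Module.End ℂ testFunctions := mulLin (ContinuousLinearMap.snd ℝ ℝ ℝ)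

/-- The differential expression `(D_x + y)² + D_y² + x` on test functions. -/
def H0expr : Module.End ℂ testFunctions := (Dx + My) ^ 2 + Dy ^ 2 + Mx

/-- The class in `L²(ℝ²)` of a test function. -/
def toL2 : testFunctions →ₗ[ℂ] L2 where
  toFun φ := (φ.2.1.continuous.memLp_of_hasCompactSupport φ.2.2 (p := 2)
    (μ := (volume : Measure (ℝ × ℝ)))).toLp φ
  map_add' _ _ := rfl
  map_smul' _ _ := rfl

/-- The graph of the closure in `L²(ℝ²)` of the operator `φ ↦ P φ` with domain `C₀^∞(ℝ²)`. -/
def closureGraph (P : Module.End ℂ testFunctions) : Submodule ℂ (L2 × L2) :=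
  (LinearMap.range (toL2.prod (toL2 ∘ₗ P))).topologicalClosure

/-- The pairs `(f, g)` in `L²(ℝ²)` such that `P f = g` in the sense of distributions, for a formally
symmetric differential expression `P`. -/
def weakGraph (P : Module.End ℂ testFunctions) : Submodule ℂ (L2 × L2) where
  carrier := {q | ∀ φ : testFunctions, ⟪toL2 (P φ), q.1⟫_ℂ = ⟪toL2 φ, q.2⟫_ℂ}
  zero_mem' _ := by simp
  add_mem' ha hb φ := by simp [inner_add_right, ha φ, hb φ]
  smul_mem' c _ ha φ := by simp [inner_smul_right, ha φ]

/-- The pairs `(f, g)` in `L²(ℝ²)` such that `g(x, y) = x f(x, y)` almost everywhere. -/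
def mulXGraph : Submodule ℂ (L2 × L2) where
  carrier := {q | ∀ᵐ p : ℝ × ℝ, q.2 p = (p.1 : ℂ) * q.1 p}
  zero_mem' := by
    filter_upwards [Lp.coeFn_zero ℂ 2 (volume : Measure (ℝ × ℝ))] with p _
    simp
  add_mem' {a b} ha hb := by
    filter_upwards [ha, hb, Lp.coeFn_add a.1 b.1, Lp.coeFn_add a.2 b.2] with p h1 h2 h3 h4
    simp only [Prod.fst_add, Prod.snd_add, h3, h4, Pi.add_apply, h1, h2, mul_add]
  smul_mem' c a ha := by
    filter_upwards [ha, Lp.coeFn_smul c a.1, Lp.coeFn_smul c a.2] with p h1 h2 h3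
    simp only [Prod.smul_fst, Prod.smul_snd, h2, h3, Pi.smul_apply, h1, smul_eq_mul]
    ring

/-- The self-adjoint operator `H₀ = (D_x + y)² + D_y² + x` on `L²(ℝ²)`: the closure of this
differential expression on `C₀^∞(ℝ²)`. -/
def H0 : L2 →ₗ.[ℂ] L2 := (closureGraph H0expr).toLinearPMap

/-- The resolvent `(H₀ - i)⁻¹`, as the inverse of the injective operator `H₀ - i`. -/
def resolventI : L2 →ₗ.[ℂ] L2 :=
  (H0 - (Complex.I • LinearMap.id : L2 →ₗ[ℂ] L2).toPMap ⊤).inverse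

/-- The operator of multiplication by `x` with its natural domain `{f ∈ L² : x f ∈ L²}`. -/
def opX : L2 →ₗ.[ℂ] L2 := mulXGraph.toLinearPMap

/-- The operator `D_x + y` with its natural domain `{f ∈ L² : (D_x + y) f ∈ L²}`. -/
def opDxy : L2 →ₗ.[ℂ] L2 := (weakGraph (Dx + My)).toLinearPMap

/-- The operator `D_y` with its natural domain `{f ∈ L² : D_y f ∈ L²}`. -/
def opDy : L2 →ₗ.[ℂ] L2 := (weakGraph Dy).toLinearPMap

/-- The product `S T` of two unbounded operators, with its natural domain
`{f ∈ dom T : T f ∈ dom S}`. -/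
def pmul (S T : L2 →ₗ.[ℂ] L2) : L2 →ₗ.[ℂ] L2 where
  domain := (S.domain.comap T.toFun).map T.domain.subtype
  toFun :=
    { toFun := fun f => S ⟨T ⟨f, by obtain ⟨g, -, hg⟩ := f.2; exact hg ▸ g.2⟩, by
        obtain ⟨f, g, hg, rfl⟩ := f; exact hg⟩
      map_add' := fun f g => by
        rw [← LinearPMap.map_add]
        congr 1
        ext1
        exact T.map_add ⟨f, by obtain ⟨g, -, hg⟩ := f.2; exact hg ▸ g.2⟩
          ⟨g, by obtain ⟨g, -, hg⟩ := g.2; exact hg ▸ g.2⟩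
      map_smul' := fun c f => by
        rw [RingHom.id_apply, ← LinearPMap.map_smul]
        congr 1
        ext1
        exact T.map_smul c ⟨f, by obtain ⟨g, -, hg⟩ := f.2; exact hg ▸ g.2⟩ }

/-- The powers `S^k` of an unbounded operator, with their natural domains. -/
def ppow (S : L2 →ₗ.[ℂ] L2) : ℕ → (L2 →ₗ.[ℂ] L2)
  | 0 => (LinearMap.id : L2 →ₗ[ℂ] L2).toPMap ⊤
  | k + 1 => pmul S (ppow S k)

/-- An operator `T` in `L²(ℝ²)` is unbounded if no constant `C` satisfies `‖T u‖ ≤ C ‖u‖` for all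
`u` in the domain of `T`. -/
def IsUnbounded (T : L2 →ₗ.[ℂ] L2) : Prop :=
  ¬ ∃ C : ℝ, ∀ u : T.domain, ‖T u‖ ≤ C * ‖(u : L2)‖

/-! ### Basic facts: the graphs used above are graphs of operators, and `H₀ - i` is injective -/

theorem toL2_ae (φ : testFunctions) : (toL2 φ : ℝ × ℝ → ℂ) =ᵐ[volume] (φ : ℝ × ℝ → ℂ) :=
  (φ.2.1.continuous.memLp_of_hasCompactSupport φ.2.2).coeFn_toLp

theorem eq_zero_of_inner_test {g : L2} (h : ∀ φ : testFunctions, ⟪toL2 φ, g⟫_ℂ = 0) : g = 0 := by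
  rw [Lp.eq_zero_iff_ae_eq_zero]
  refine ae_eq_zero_of_integral_contDiff_smul_eq_zero
    ((Lp.memLp g).locallyIntegrable (by norm_num)) fun φ h1 h2 => ?_
  let ψ : testFunctions := ⟨fun p => (φ p : ℂ), Complex.ofRealCLM.contDiff.comp h1,
    h2.comp_left (g := fun r : ℝ => (r : ℂ)) (by simp)⟩
  rw [← h ψ, L2.inner_def]
  refine integral_congr_ae ?_
  have : (toL2 ψ : ℝ × ℝ → ℂ) =ᵐ[volume] fun p => (φ p : ℂ) := toL2_ae ψ
  filter_upwards [this] with p hp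
  rw [hp]
  simp [RCLike.inner_apply, mul_comm]

theorem weakGraph_functional (P : Module.End ℂ testFunctions) (q : L2 × L2) (hq : q ∈ weakGraph P)
    (h0 : q.1 = 0) : q.2 = 0 :=
  eq_zero_of_inner_test fun φ => by rw [← hq φ, h0, inner_zero_right]

theorem opDxy_graph : opDxy.graph = weakGraph (Dx + My) :=
  Submodule.toLinearPMap_graph_eq _ (weakGraph_functional _)

theorem opDy_graph : opDy.graph = weakGraph Dy :=
  Submodule.toLinearPMap_graph_eq _ (weakGraph_functional _)

theorem opX_graph : opX.graph = mulXGraph := by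
  refine Submodule.toLinearPMap_graph_eq _ fun q hq h0 => ?_
  rw [Lp.eq_zero_iff_ae_eq_zero]
  filter_upwards [hq, (Lp.eq_zero_iff_ae_eq_zero).1 h0] with p h1 h2
  simp [h1, h2]

theorem pmul_graph (S T : L2 →ₗ.[ℂ] L2) (u w : L2) :
    (u, w) ∈ (pmul S T).graph ↔ ∃ v, (u, v) ∈ T.graph ∧ (v, w) ∈ S.graph := by
  simp only [LinearPMap.mem_graph_iff]
  constructor
  · rintro ⟨⟨_, f, hf, rfl⟩, rfl, rfl⟩
    exact ⟨T f, ⟨f, rfl, rfl⟩, ⟨⟨T f, hf⟩, rfl, rfl⟩⟩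
  · rintro ⟨_, ⟨f, rfl, rfl⟩, ⟨⟨_, hg⟩, rfl, rfl⟩⟩
    exact ⟨⟨f, f, hg, rfl⟩, rfl, rfl⟩

/-- A differential expression on test functions is formally symmetric for the `L²` product. -/
def FormallySymmetric (P : Module.End ℂ testFunctions) : Prop :=
  ∀ φ ψ : testFunctions, ⟪toL2 (P φ), toL2 ψ⟫_ℂ = ⟪toL2 φ, toL2 (P ψ)⟫_ℂ

theorem FormallySymmetric.add {P Q : Module.End ℂ testFunctions} (hP : FormallySymmetric P)
    (hQ : FormallySymmetric Q) : FormallySymmetric (P + Q) := fun φ ψ => by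
  simp [inner_add_left, inner_add_right, hP φ ψ, hQ φ ψ]

theorem FormallySymmetric.sq {P : Module.End ℂ testFunctions} (hP : FormallySymmetric P) :
    FormallySymmetric (P ^ 2) := fun φ ψ => by
  simp [pow_two, hP (P φ) ψ, hP φ (P ψ)]

theorem inner_toL2 (φ ψ : testFunctions) : ⟪toL2 φ, toL2 ψ⟫_ℂ =
    ∫ p, (ψ : ℝ × ℝ → ℂ) p * (starRingEnd ℂ) ((φ : ℝ × ℝ → ℂ) p) := by
  rw [L2.inner_def]
  refine integral_congr_ae ?_
  filter_upwards [toL2_ae φ, toL2_ae ψ] with p h1 h2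
  rw [h1, h2, RCLike.inner_apply]

theorem formallySymmetric_mulLin (l : ℝ × ℝ →L[ℝ] ℝ) : FormallySymmetric (mulLin l) :=
  fun φ ψ => by
  rw [inner_toL2, inner_toL2]
  congr 1
  ext p
  simp only [mulLin, LinearMap.coe_mk, AddHom.coe_mk, map_mul, Complex.conj_ofReal]
  ring

theorem formallySymmetric_dirD (v : ℝ × ℝ) : FormallySymmetric (dirD v) := fun φ ψ => by
  rw [inner_toL2, inner_toL2]
  let f : ℝ × ℝ → ℂ := fun p => (starRingEnd ℂ) ((φ : ℝ × ℝ → ℂ) p)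
  have hf : ContDiff ℝ ∞ f := Complex.conjCLE.contDiff.comp φ.2.1
  have hfs : HasCompactSupport f := φ.2.2.comp_left (g := starRingEnd ℂ) (by simp)
  have hd : ∀ p, (starRingEnd ℂ) (fderiv ℝ (φ : ℝ × ℝ → ℂ) p v) = fderiv ℝ f p v := fun p => by
    have h := (Complex.conjCLE.toContinuousLinearMap.hasFDerivAt.comp p
      ((φ.2.1.differentiable (by simp)) p).hasFDerivAt).fderiv
    exact (congrArg (fun L => L v) h).symm
  have hcf : Continuous fun p => fderiv ℝ f p v :=
    (hf.continuous_fderiv (by simp)).clm_apply continuous_const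
  have hcg : Continuous fun p => fderiv ℝ (ψ : ℝ × ℝ → ℂ) p v :=
    (ψ.2.1.continuous_fderiv (by simp)).clm_apply continuous_const
  have key := integral_mul_fderiv_eq_neg_fderiv_mul_of_integrable
    (μ := (volume : Measure (ℝ × ℝ))) (f := f) (g := (ψ : ℝ × ℝ → ℂ)) (v := v)
    ((hcf.mul ψ.2.1.continuous).integrable_of_hasCompactSupport ψ.2.2.mul_left)
    ((hf.continuous.mul hcg).integrable_of_hasCompactSupport hfs.mul_right)
    ((hf.continuous.mul ψ.2.1.continuous).integrable_of_hasCompactSupport hfs.mul_right)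
    (fun p _ => (hf.differentiable (by simp)) p)
    (fun p _ => (ψ.2.1.differentiable (by simp)) p)
  have e1 : ∀ p, (ψ : ℝ × ℝ → ℂ) p * (starRingEnd ℂ) ((dirD v φ : ℝ × ℝ → ℂ) p)
      = Complex.I * (fderiv ℝ f p v * (ψ : ℝ × ℝ → ℂ) p) := fun p => by
    simp only [dirD, LinearMap.coe_mk, AddHom.coe_mk, map_mul, map_neg, Complex.conj_I, hd]
    ring
  have e2 : ∀ p, (dirD v ψ : ℝ × ℝ → ℂ) p * (starRingEnd ℂ) ((φ : ℝ × ℝ → ℂ) p)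
      = -Complex.I * (f p * fderiv ℝ (ψ : ℝ × ℝ → ℂ) p v) := fun p => by
    simp only [dirD, LinearMap.coe_mk, AddHom.coe_mk, f]
    ring
  simp only [e1, e2, integral_const_mul, key]
  ring

theorem formallySymmetric_H0expr : FormallySymmetric H0expr :=
  (((formallySymmetric_dirD _).add (formallySymmetric_mulLin _)).sq.add
    (formallySymmetric_dirD _).sq).add (formallySymmetric_mulLin _)

theorem closureGraph_symm {P : Module.End ℂ testFunctions} (hP : FormallySymmetric P)
    {q r : L2 × L2} (hq : q ∈ closureGraph P) (hr : r ∈ closureGraph P) :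
    ⟪q.2, r.1⟫_ℂ = ⟪q.1, r.2⟫_ℂ := by
  have step : ∀ φ : testFunctions, ∀ r ∈ closureGraph P,
      ⟪toL2 (P φ), r.1⟫_ℂ = ⟪toL2 φ, r.2⟫_ℂ := fun φ r hr => by
    refine closure_minimal (s := (LinearMap.range (toL2.prod (toL2 ∘ₗ P)) : Set (L2 × L2)))
      (t := {r | ⟪toL2 (P φ), r.1⟫_ℂ = ⟪toL2 φ, r.2⟫_ℂ}) ?_
      (isClosed_eq (by fun_prop) (by fun_prop)) hr
    rintro _ ⟨ψ, rfl⟩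
    exact hP φ ψ
  refine closure_minimal (s := (LinearMap.range (toL2.prod (toL2 ∘ₗ P)) : Set (L2 × L2)))
    (t := {q | ⟪q.2, r.1⟫_ℂ = ⟪q.1, r.2⟫_ℂ}) ?_ (isClosed_eq (by fun_prop) (by fun_prop)) hq
  rintro _ ⟨φ, rfl⟩
  exact step φ r hr

theorem H0_graph : H0.graph = closureGraph H0expr := by
  refine Submodule.toLinearPMap_graph_eq _ fun q hq h0 => eq_zero_of_inner_test fun φ => ?_
  have hφ : (toL2 φ, toL2 (H0expr φ)) ∈ closureGraph H0expr :=
    Submodule.le_topologicalClosure _ ⟨φ, rfl⟩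
  have := closureGraph_symm formallySymmetric_H0expr hφ hq
  rw [← this, h0, inner_zero_right]

/-- `H₀ - i` is injective. -/
theorem ker_H0_sub_I :
    LinearMap.ker (H0 - (Complex.I • LinearMap.id : L2 →ₗ[ℂ] L2).toPMap ⊤).toFun = ⊥ := by
  rw [LinearMap.ker_eq_bot']
  rintro ⟨f, hf, _⟩ h
  have h1 : H0 ⟨f, hf⟩ = Complex.I • f := sub_eq_zero.1 h
  have h2 : (f, Complex.I • f) ∈ closureGraph H0expr := by
    rw [← H0_graph, ← h1]
    exact H0.mem_graph ⟨f, hf⟩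
  have h3 := closureGraph_symm formallySymmetric_H0expr h2 h2
  simp only [inner_smul_left, inner_smul_right, Complex.conj_I] at h3
  have h4 : (2 * Complex.I) * ⟪f, f⟫_ℂ = 0 := by linear_combination -h3
  have h5 : f = 0 := by simpa using h4
  exact Subtype.ext h5

theorem resolventI_graph (u f : L2) :
    (u, f) ∈ resolventI.graph ↔ ∃ g, (f, g) ∈ H0.graph ∧ u = g - Complex.I • f := by
  rw [resolventI, LinearPMap.inverse_graph ker_H0_sub_I]
  simp only [Submodule.mem_map, Prod.exists, LinearPMap.mem_graph_iff]
  constructor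
  · rintro ⟨_, _, ⟨⟨a, ha, _⟩, rfl, rfl⟩, h⟩
    obtain ⟨rfl, rfl⟩ := Prod.ext_iff.1 h
    exact ⟨H0 ⟨a, ha⟩, ⟨⟨a, ha⟩, rfl, rfl⟩, rfl⟩
  · rintro ⟨_, ⟨⟨a, ha⟩, rfl, rfl⟩, rfl⟩
    exact ⟨a, _, ⟨⟨a, ha, trivial⟩, rfl, rfl⟩, rfl⟩

end

end LandauStark

open LandauStark

namespace LandauStark

noncomputable section

/-! Boosts defeat the relative bounds. Multiplying by `e^{itℓ}`, with `ℓ` linear and its coefficient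
vector of length one, raises the kinetic energy by `t²` plus a term linear in `t`; moving the
function by `-t²` along `x` lowers the potential by exactly `t²`. With `P = D_x + y` or `P = D_y`
and the matching coordinate `ℓ`, `H₀` thus becomes `H₀ + 2tP` while `P` becomes `P + t`. Since `P`
is a derivative up to a phase, dilation gives `χ` with `‖Pχ‖` tiny against `‖χ‖`; for large `t` the
growth `t‖χ‖` of `P` beats the growth `2t‖Pχ‖` of `H₀` (`exists_norm_gt`). The squares and `x`
reduce to this case through quadratic forms: a bound on `P²` or on `x` relative to `H₀ - i` would
bound `P`, respectively `D_y`. -/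

/-- The substitution `f ↦ e^{iθ(p)} f(c p + b)` on test functions. -/
def phaseAffine (θ : ℝ × ℝ → ℝ) (hθ : ContDiff ℝ ∞ θ) (c : ℝ) (hc : c ≠ 0) (b : ℝ × ℝ) :
    Module.End ℂ testFunctions where
  toFun f := ⟨fun p => Complex.exp (θ p * Complex.I) * (f : ℝ × ℝ → ℂ) (c • p + b),
    ((Complex.ofRealCLM.contDiff.comp hθ).mul contDiff_const).cexp.mul
      (f.2.1.comp ((contDiff_const_smul c).add contDiff_const)),
    (f.2.2.comp_homeomorph ((Homeomorph.smulOfNeZero c hc).trans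
      (Homeomorph.addRight b))).mul_left⟩
  map_add' f g := by
    ext p
    simp [mul_add]
  map_smul' c f := by
    ext p
    simp
    ring

/-! ### Derivatives and norms under phase and affine change of variable. -/

section phaseAffine

variable (θ : ℝ × ℝ → ℝ) (hθ : ContDiff ℝ ∞ θ) (c : ℝ) (hc : c ≠ 0) (b : ℝ × ℝ)
  (f : testFunctions)

theorem phaseAffine_apply (p : ℝ × ℝ) : (phaseAffine θ hθ c hc b f : ℝ × ℝ → ℂ) p =
    Complex.exp (θ p * Complex.I) * (f : ℝ × ℝ → ℂ) (c • p + b) := rfl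

theorem dirD_apply (v p : ℝ × ℝ) :
    (dirD v f : ℝ × ℝ → ℂ) p = -Complex.I * fderiv ℝ (f : ℝ × ℝ → ℂ) p v := rfl

theorem mulLin_apply (l : ℝ × ℝ →L[ℝ] ℝ) (p : ℝ × ℝ) :
    (mulLin l f : ℝ × ℝ → ℂ) p = (l p : ℂ) * (f : ℝ × ℝ → ℂ) p := rfl

theorem dirD_phaseAffine_apply (v p : ℝ × ℝ) :
    (dirD v (phaseAffine θ hθ c hc b f) : ℝ × ℝ → ℂ) p =
      (fderiv ℝ θ p v : ℂ) * (phaseAffine θ hθ c hc b f : ℝ × ℝ → ℂ) p +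
        c * (phaseAffine θ hθ c hc b (dirD v f) : ℝ × ℝ → ℂ) p := by
  have h1 : HasFDerivAt θ (fderiv ℝ θ p) p := ((hθ.differentiable (by simp)) p).hasFDerivAt
  have h2 : HasFDerivAt (fun p => (θ p : ℂ) * Complex.I)
      (Complex.I • (Complex.ofRealCLM.comp (fderiv ℝ θ p))) p :=
    (Complex.ofRealCLM.hasFDerivAt.comp p h1).mul_const Complex.I
  have h3 : HasFDerivAt (fun p : ℝ × ℝ => c • p + b)
      (c • ContinuousLinearMap.id ℝ (ℝ × ℝ)) p :=
    ((hasFDerivAt_id p).const_smul c).add_const b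
  have h4 := ((f.2.1.differentiable (by simp)) (c • p + b)).hasFDerivAt.comp p h3
  have h5 : HasFDerivAt (phaseAffine θ hθ c hc b f : ℝ × ℝ → ℂ) _ p := h2.cexp.mul h4
  simp only [dirD_apply, h5.fderiv, phaseAffine_apply, add_apply,
    smul_apply, ContinuousLinearMap.comp_apply, Complex.ofRealCLM_apply,
    ContinuousLinearMap.id_apply, map_smul, smul_eq_mul, Complex.real_smul]
  linear_combination (-(fderiv ℝ θ p v : ℂ) * Complex.exp (θ p * Complex.I) *
    (f : ℝ × ℝ → ℂ) (c • p + b)) * Complex.I_sq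

/-- The phase has modulus one, and dilation by `c` in the plane has Jacobian `c²`. -/
theorem norm_toL2_phaseAffine :
    ‖toL2 (phaseAffine θ hθ c hc b f)‖ = |c|⁻¹ * ‖toL2 f‖ := by
  have key : ⟪toL2 (phaseAffine θ hθ c hc b f), toL2 (phaseAffine θ hθ c hc b f)⟫_ℂ =
      (|c|⁻¹ ^ 2 : ℝ) * ⟪toL2 f, toL2 f⟫_ℂ := by
    rw [inner_toL2, inner_toL2]
    let g : ℝ × ℝ → ℂ := fun p => (f : ℝ × ℝ → ℂ) p * (starRingEnd ℂ) ((f : ℝ × ℝ → ℂ) p)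
    have e : ∀ p, (phaseAffine θ hθ c hc b f : ℝ × ℝ → ℂ) p *
        (starRingEnd ℂ) ((phaseAffine θ hθ c hc b f : ℝ × ℝ → ℂ) p) = g (c • p + b) := fun p => by
      have h : Complex.exp (θ p * Complex.I) *
          (starRingEnd ℂ) (Complex.exp (θ p * Complex.I)) = 1 := by
        rw [Complex.mul_conj, Complex.normSq_eq_norm_sq, Complex.norm_exp_ofReal_mul_I]
        simp
      simp only [phaseAffine_apply, g, map_mul]
      linear_combination ((f : ℝ × ℝ → ℂ) (c • p + b) *
        (starRingEnd ℂ) ((f : ℝ × ℝ → ℂ) (c • p + b))) * h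
    simp only [e]
    rw [Measure.integral_comp_smul volume (fun q => g (q + b)) c, integral_add_right_eq_self g b]
    simp [g, Complex.real_smul]
  rw [inner_self_eq_norm_sq_to_K, inner_self_eq_norm_sq_to_K] at key
  have h2 : ‖toL2 (phaseAffine θ hθ c hc b f)‖ ^ 2 = (|c|⁻¹ * ‖toL2 f‖) ^ 2 := by
    rw [mul_pow]
    apply Complex.ofReal_injective
    rw [Complex.ofReal_mul, Complex.ofReal_pow, Complex.ofReal_pow ‖toL2 f‖]
    exact key
  exact (pow_left_inj₀ (norm_nonneg _) (by positivity) two_ne_zero).1 h2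

end phaseAffine

/-! ### Absence of a positive lower bound for `D_y` and `D_x + y`. -/

theorem exists_toL2_ne_zero : ∃ ψ : testFunctions, toL2 ψ ≠ 0 := by
  let B : ContDiffBump (0 : ℝ × ℝ) := ⟨1, 2, one_pos, one_lt_two⟩
  let ψ : testFunctions := ⟨fun p => (B p : ℂ), Complex.ofRealCLM.contDiff.comp B.contDiff,
    B.hasCompactSupport.comp_left (g := fun r : ℝ => (r : ℂ)) (by simp)⟩
  refine ⟨ψ, fun h => ?_⟩
  have h1 : (ψ : ℝ × ℝ → ℂ) =ᵐ[volume] fun _ => 0 :=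
    (toL2_ae ψ).symm.trans ((Lp.eq_zero_iff_ae_eq_zero).1 h)
  have h2 := congrFun ((ψ.2.1.continuous.ae_eq_iff_eq volume continuous_const).1 h1) 0
  have h3 : B 0 = 1 := B.one_of_mem_closedBall (by simp [B])
  simp [ψ, h3] at h2

/-- If, up to a phase factor, `P` is a directional derivative, then it does not have a positive
lower bound on test functions. -/
theorem exists_norm_lt_of_gauge {P : Module.End ℂ testFunctions} (θ : ℝ × ℝ → ℝ)
    (hθ : ContDiff ℝ ∞ θ) (v : ℝ × ℝ)
    (hP : ∀ (c : ℝ) (hc : c ≠ 0) (f : testFunctions),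
      P (phaseAffine θ hθ c hc 0 f) = (c : ℂ) • phaseAffine θ hθ c hc 0 (dirD v f))
    {ε : ℝ} (hε : 0 < ε) : ∃ χ : testFunctions, ‖toL2 (P χ)‖ < ε * ‖toL2 χ‖ := by
  obtain ⟨ψ, hψ⟩ := exists_toL2_ne_zero
  have hψ' : 0 < ‖toL2 ψ‖ := norm_pos_iff.2 hψ
  -- Dilation multiplies the ratio of norms by `c`, so `c‖D_v ψ‖ < ε‖ψ‖` is needed; the `+ 1` keeps
  -- the denominator positive and the inequality strict.
  set c : ℝ := ε * ‖toL2 ψ‖ / (‖toL2 (dirD v ψ)‖ + 1) with hcdef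
  have hc : 0 < c := by positivity
  refine ⟨phaseAffine θ hθ c hc.ne' 0 ψ, ?_⟩
  rw [hP, map_smul, norm_smul, norm_toL2_phaseAffine, norm_toL2_phaseAffine, abs_of_pos hc,
    Complex.norm_real, Real.norm_of_nonneg hc.le, mul_inv_cancel_left₀ hc.ne',
    mul_left_comm, lt_inv_mul_iff₀ hc, hcdef, div_mul_eq_mul_div, div_lt_iff₀ (by positivity)]
  exact mul_lt_mul_of_pos_left (lt_add_one _) (by positivity)

theorem exists_norm_Dy_lt {ε : ℝ} (hε : 0 < ε) :
    ∃ χ : testFunctions, ‖toL2 (Dy χ)‖ < ε * ‖toL2 χ‖ := by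
  refine exists_norm_lt_of_gauge (fun _ => 0) contDiff_const (0, 1) (fun c hc f => ?_) hε
  ext p
  rw [Dy, dirD_phaseAffine_apply]
  simp

theorem exists_norm_Dx_add_My_lt {ε : ℝ} (hε : 0 < ε) :
    ∃ χ : testFunctions, ‖toL2 ((Dx + My) χ)‖ < ε * ‖toL2 χ‖ := by
  -- The phase `-xy` has `x`-derivative `-y`, which gauges away the potential `y`.
  refine exists_norm_lt_of_gauge (fun p => -(p.1 * p.2)) (contDiff_fst.mul contDiff_snd).neg
    (1, 0) (fun c hc f => ?_) hε
  ext p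
  have h : HasFDerivAt (fun p : ℝ × ℝ => -(p.1 * p.2)) _ p :=
    ((hasFDerivAt_fst (𝕜 := ℝ) (E := ℝ) (F := ℝ) (p := p)).mul
      (hasFDerivAt_snd (𝕜 := ℝ) (E := ℝ) (F := ℝ) (p := p))).neg
  rw [LinearMap.add_apply, Submodule.coe_add, Pi.add_apply, Dx, My, dirD_phaseAffine_apply,
    mulLin_apply, h.fderiv]
  simp

/-! ### Boosts and their commutation with the operators. -/

/-- Multiplication by `e^{iλℓ}` followed by a translation in the `x` direction by `-λ²`. -/
def boost (l : ℝ × ℝ →L[ℝ] ℝ) (t : ℝ) : Module.End ℂ testFunctions :=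
  phaseAffine (fun p => t * l p) (contDiff_const.mul l.contDiff) 1 one_ne_zero (t ^ 2, 0)

theorem norm_toL2_boost (l : ℝ × ℝ →L[ℝ] ℝ) (t : ℝ) (f : testFunctions) :
    ‖toL2 (boost l t f)‖ = ‖toL2 f‖ := by
  simp [boost, norm_toL2_phaseAffine]

theorem dirD_boost (l : ℝ × ℝ →L[ℝ] ℝ) (t : ℝ) (v : ℝ × ℝ) (f : testFunctions) :
    dirD v (boost l t f) = boost l t (dirD v f + ((t * l v : ℝ) : ℂ) • f) := by
  ext p
  have h : HasFDerivAt (fun p => t * l p) (t • l) p := l.hasFDerivAt.const_mul t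
  rw [boost, dirD_phaseAffine_apply, h.fderiv, map_add, map_smul]
  simp [add_comm]

theorem mulLin_boost (l m : ℝ × ℝ →L[ℝ] ℝ) (t : ℝ) (f : testFunctions) :
    mulLin m (boost l t f) = boost l t (mulLin m f - ((t ^ 2 * m (1, 0) : ℝ) : ℂ) • f) := by
  ext p
  have h : m (p + (t ^ 2, 0)) = m p + t ^ 2 * m (1, 0) := by
    rw [map_add, ← smul_eq_mul (t ^ 2), ← map_smul]
    simp
  rw [mulLin_apply, boost, phaseAffine_apply, phaseAffine_apply]
  simp only [Submodule.coe_sub, Submodule.coe_smul, Pi.sub_apply, Pi.smul_apply, mulLin_apply,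
    one_smul, h, smul_eq_mul]
  push_cast
  ring

theorem Dy_boost (l : ℝ × ℝ →L[ℝ] ℝ) (t : ℝ) (f : testFunctions) :
    Dy (boost l t f) = boost l t (Dy f + ((t * l (0, 1) : ℝ) : ℂ) • f) :=
  dirD_boost l t _ f

theorem Dx_add_My_boost (l : ℝ × ℝ →L[ℝ] ℝ) (t : ℝ) (f : testFunctions) :
    (Dx + My) (boost l t f) = boost l t ((Dx + My) f + ((t * l (1, 0) : ℝ) : ℂ) • f) := by
  rw [LinearMap.add_apply, Dx, My, dirD_boost, mulLin_boost, ← map_add]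
  congr 1
  simp only [ContinuousLinearMap.coe_snd', mul_zero, Complex.ofReal_zero, zero_smul, sub_zero,
    LinearMap.add_apply]
  abel

/-- Completing the squares leaves `t²|ℓ|² = t²`, which cancels the `-t²` from translating `x`; only
the cross term survives. -/
theorem H0expr_boost (l : ℝ × ℝ →L[ℝ] ℝ) (hl : l (1, 0) ^ 2 + l (0, 1) ^ 2 = 1) (t : ℝ)
    (f : testFunctions) : H0expr (boost l t f) = boost l t (H0expr f +
      ((2 * t : ℝ) : ℂ) • ((l (1, 0) : ℂ) • (Dx + My) f + (l (0, 1) : ℂ) • Dy f)) := by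
  have hl' : ((l (1, 0) : ℝ) : ℂ) ^ 2 + ((l (0, 1) : ℝ) : ℂ) ^ 2 = 1 := by exact_mod_cast hl
  have e : ∀ g, H0expr g = (Dx + My) ((Dx + My) g) + Dy (Dy g) + Mx g := fun g => by
    simp [H0expr, pow_two]
  rw [e, e, Dx_add_My_boost, Dx_add_My_boost, Dy_boost, Dy_boost, Mx, mulLin_boost,
    ← map_add, ← map_add]
  congr 1
  simp only [map_add, map_smul, ContinuousLinearMap.coe_fst', mul_one]
  push_cast
  generalize (Dx + My) f = X
  match_scalars <;> first | linear_combination (t : ℂ) ^ 2 * hl' | ring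

/-! ### Failure of the first-order relative bounds. -/

/-- The relative bound fails for an expression which has no positive lower bound on test functions,
and which the boosts shift by a constant. -/
theorem exists_norm_gt (P : Module.End ℂ testFunctions) (l : ℝ × ℝ →L[ℝ] ℝ)
    (hP : ∀ {ε : ℝ}, 0 < ε → ∃ χ : testFunctions, ‖toL2 (P χ)‖ < ε * ‖toL2 χ‖)
    (hPb : ∀ (t : ℝ) (f : testFunctions), P (boost l t f) = boost l t (P f + (t : ℂ) • f))
    (hHb : ∀ (t : ℝ) (f : testFunctions),
      H0expr (boost l t f) = boost l t (H0expr f + ((2 * t : ℝ) : ℂ) • P f)) (C : ℝ) :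
    ∃ φ : testFunctions, C * ‖toL2 (H0expr φ) - Complex.I • toL2 φ‖ < ‖toL2 (P φ)‖ := by
  have hK : 0 < |C| + 1 := by positivity
  -- This makes the linear term `(|C| + 1) * 2tp` cost less than half of `t * n`; the choice of `t`
  -- below lets the other half exceed the fixed terms `(|C| + 1) * A + p` by one.
  obtain ⟨χ, hχ⟩ := hP (ε := (4 * (|C| + 1))⁻¹) (by positivity)
  rw [lt_inv_mul_iff₀ (by positivity)] at hχ
  set A := ‖toL2 (H0expr χ) - Complex.I • toL2 χ‖ with hA
  set p := ‖toL2 (P χ)‖ with hp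
  set n := ‖toL2 χ‖ with hn
  have hA0 : 0 ≤ A := norm_nonneg _
  have hp0 : 0 ≤ p := norm_nonneg _
  have hn0 : 0 < n := by nlinarith
  set t : ℝ := 2 * ((|C| + 1) * A + p + 1) / n with ht
  have ht0 : 0 < t := by positivity
  have htn : t * n = 2 * ((|C| + 1) * A + p + 1) := by rw [ht]; field_simp
  refine ⟨boost l t χ, ?_⟩
  have e1 : toL2 (H0expr (boost l t χ)) - Complex.I • toL2 (boost l t χ) =
      toL2 (boost l t (H0expr χ + ((2 * t : ℝ) : ℂ) • P χ - Complex.I • χ)) := by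
    rw [hHb, map_sub (boost l t), map_smul (boost l t), map_sub toL2, map_smul toL2]
  have h1 : ‖toL2 (H0expr (boost l t χ)) - Complex.I • toL2 (boost l t χ)‖ ≤ A + 2 * t * p := by
    rw [e1, norm_toL2_boost, map_sub, map_add, map_smul, map_smul, add_sub_right_comm]
    refine (norm_add_le _ _).trans_eq ?_
    rw [norm_smul, Complex.norm_real, Real.norm_of_nonneg (by positivity)]
  have h2 : t * n - p ≤ ‖toL2 (P (boost l t χ))‖ := by
    rw [hPb, norm_toL2_boost, map_add, map_smul, add_comm]
    have := norm_sub_norm_le (((t : ℂ) • toL2 χ)) (-(toL2 (P χ)))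
    rwa [sub_neg_eq_add, norm_neg, norm_smul, Complex.norm_real, Real.norm_of_nonneg ht0.le]
      at this
  have h3 : C * ‖toL2 (H0expr (boost l t χ)) - Complex.I • toL2 (boost l t χ)‖ ≤
      (|C| + 1) * (A + 2 * t * p) :=
    mul_le_mul (by linarith [le_abs_self C]) h1 (norm_nonneg _) hK.le
  have h4 : t * (4 * (|C| + 1) * p) < t * n := mul_lt_mul_of_pos_left hχ ht0
  linarith

theorem exists_norm_Dx_add_My_gt (C : ℝ) : ∃ φ : testFunctions,
    C * ‖toL2 (H0expr φ) - Complex.I • toL2 φ‖ < ‖toL2 ((Dx + My) φ)‖ := by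
  refine exists_norm_gt _ (ContinuousLinearMap.fst ℝ ℝ ℝ) exists_norm_Dx_add_My_lt
    (fun t f => ?_) (fun t f => ?_) C
  · rw [Dx_add_My_boost]; simp
  · simp [H0expr_boost]

theorem exists_norm_Dy_gt (C : ℝ) : ∃ φ : testFunctions,
    C * ‖toL2 (H0expr φ) - Complex.I • toL2 φ‖ < ‖toL2 (Dy φ)‖ := by
  refine exists_norm_gt _ (ContinuousLinearMap.snd ℝ ℝ ℝ) exists_norm_Dy_lt
    (fun t f => ?_) (fun t f => ?_) C
  · simp [Dy_boost]
  · simp [H0expr_boost]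

/-! ### Quadratic form inequalities. -/

/-- Symmetry makes `⟨φ, H₀φ⟩` real, so `⟨φ, (H₀ - i)φ⟩` has imaginary part `-‖φ‖²`; then
Cauchy–Schwarz. -/
theorem norm_toL2_le (φ : testFunctions) :
    ‖toL2 φ‖ ≤ ‖toL2 (H0expr φ) - Complex.I • toL2 φ‖ := by
  have hs := formallySymmetric_H0expr φ φ
  have h1 : (⟪toL2 φ, toL2 (H0expr φ)⟫_ℂ).im = 0 := by
    rw [← Complex.conj_eq_iff_im, inner_conj_symm, hs]
  have h2 : (⟪toL2 φ, toL2 (H0expr φ) - Complex.I • toL2 φ⟫_ℂ).im = -‖toL2 φ‖ ^ 2 := by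
    rw [inner_sub_right, inner_smul_right, inner_self_eq_norm_sq_to_K, Complex.sub_im, h1]
    simp [← Complex.ofReal_pow]
  have h3 := (Complex.abs_im_le_norm _).trans (norm_inner_le_norm (𝕜 := ℂ) (toL2 φ)
    (toL2 (H0expr φ) - Complex.I • toL2 φ))
  rw [h2, abs_neg, abs_of_nonneg (by positivity), pow_two] at h3
  rcases (norm_nonneg (toL2 φ)).eq_or_lt with h | h
  · rw [← h]; exact norm_nonneg _
  · exact le_of_mul_le_mul_left h3 h

theorem FormallySymmetric.inner_sq {P : Module.End ℂ testFunctions} (hP : FormallySymmetric P)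
    (φ : testFunctions) : ⟪toL2 φ, toL2 ((P ^ 2) φ)⟫_ℂ = ((‖toL2 (P φ)‖ ^ 2 : ℝ) : ℂ) := by
  rw [pow_two, Module.End.mul_apply, ← hP, inner_self_eq_norm_sq_to_K]
  simp

theorem FormallySymmetric.norm_sq_le {P : Module.End ℂ testFunctions} (hP : FormallySymmetric P)
    (φ : testFunctions) : ‖toL2 (P φ)‖ ^ 2 ≤ ‖toL2 φ‖ * ‖toL2 ((P ^ 2) φ)‖ := by
  have h := norm_inner_le_norm (𝕜 := ℂ) (toL2 φ) (toL2 ((P ^ 2) φ))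
  rwa [hP.inner_sq, Complex.norm_real, Real.norm_of_nonneg (by positivity)] at h

theorem formallySymmetric_Dx_add_My : FormallySymmetric (Dx + My) :=
  (formallySymmetric_dirD _).add (formallySymmetric_mulLin _)

theorem formallySymmetric_Dy : FormallySymmetric Dy := formallySymmetric_dirD _

/-- Since `⟨φ, (H₀ - x)φ⟩ = ‖(D_x + y)φ‖² + ‖D_y φ‖²`, the first square can be dropped. -/
theorem norm_Dy_sq_le (φ : testFunctions) :
    ‖toL2 (Dy φ)‖ ^ 2 ≤ ‖toL2 φ‖ * ‖toL2 (H0expr φ) - toL2 (Mx φ)‖ := by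
  have h := norm_inner_le_norm (𝕜 := ℂ) (toL2 φ) (toL2 (H0expr φ) - toL2 (Mx φ))
  have e : toL2 (H0expr φ) - toL2 (Mx φ) = toL2 (((Dx + My) ^ 2) φ) + toL2 ((Dy ^ 2) φ) := by
    simp [H0expr]
  rw [e, inner_add_right, formallySymmetric_Dx_add_My.inner_sq, formallySymmetric_Dy.inner_sq,
    ← Complex.ofReal_add, Complex.norm_real, Real.norm_of_nonneg (by positivity), ← e] at h
  linarith [sq_nonneg ‖toL2 ((Dx + My) φ)‖]

/-! ### Passage to the unbounded operators. -/

/-- The vectors `u = (H₀ - i)φ` suffice: the resolvent sends `u` back to `φ`, so a bound on the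
product would be a relative bound on test functions. -/
theorem isUnbounded_pmul_resolventI {S : L2 →ₗ.[ℂ] L2} {P : Module.End ℂ testFunctions}
    (hS : ∀ φ, (toL2 φ, toL2 (P φ)) ∈ S.graph)
    (hP : ∀ C : ℝ, ∃ φ : testFunctions,
      C * ‖toL2 (H0expr φ) - Complex.I • toL2 φ‖ < ‖toL2 (P φ)‖) :
    IsUnbounded (pmul S resolventI) := by
  rintro ⟨C, hC⟩
  obtain ⟨φ, hφ⟩ := hP C
  have h1 : (toL2 φ, toL2 (H0expr φ)) ∈ H0.graph := by
    rw [H0_graph]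
    exact Submodule.le_topologicalClosure _ ⟨φ, rfl⟩
  have h2 := (pmul_graph S resolventI _ _).2 ⟨_, (resolventI_graph _ _).2 ⟨_, h1, rfl⟩, hS φ⟩
  obtain ⟨u, hu, hw⟩ := (LinearPMap.mem_graph_iff _).1 h2
  have h3 := hC u
  rw [hw, hu] at h3
  exact hφ.not_ge h3

theorem isUnbounded_ppow_resolventI {S : L2 →ₗ.[ℂ] L2} {P : Module.End ℂ testFunctions}
    (hsymm : FormallySymmetric P) (hS : S.graph = weakGraph P)
    (hP : ∀ C : ℝ, ∃ φ : testFunctions,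
      C * ‖toL2 (H0expr φ) - Complex.I • toL2 φ‖ < ‖toL2 (P φ)‖) (k : ℕ) (hk : k = 1 ∨ k = 2) :
    IsUnbounded (pmul (ppow S k) resolventI) := by
  have hg : ∀ (k : ℕ) (φ : testFunctions), (toL2 φ, toL2 ((P ^ k) φ)) ∈ (ppow S k).graph := by
    intro k φ
    induction k with
    | zero => exact (LinearPMap.mem_graph_iff _).2 ⟨⟨toL2 φ, trivial⟩, rfl, rfl⟩
    | succ k ih =>
      refine (pmul_graph _ _ _ _).2 ⟨_, ih, ?_⟩
      rw [hS, pow_succ']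
      exact fun ψ => hsymm ψ _
  refine isUnbounded_pmul_resolventI (hg k) fun C => ?_
  rcases hk with rfl | rfl
  · simpa using hP C
  -- If `‖P²φ‖ ≤ C * r`, then `‖Pφ‖² ≤ ‖φ‖‖P²φ‖ ≤ |C| * r²`, contradicting `‖Pφ‖ > (|C| + 1) * r`.
  · obtain ⟨φ, hφ⟩ := hP (|C| + 1)
    refine ⟨φ, ?_⟩
    by_contra! h
    have h1 := hsymm.norm_sq_le φ
    have h2 := norm_toL2_le φ
    set r := ‖toL2 (H0expr φ) - Complex.I • toL2 φ‖
    have hr : 0 ≤ r := norm_nonneg _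
    have h3 : ‖toL2 φ‖ * ‖toL2 ((P ^ 2) φ)‖ ≤ r * (|C| * r) :=
      mul_le_mul h2 (h.trans (mul_le_mul_of_nonneg_right (le_abs_self C) hr)) (norm_nonneg _) hr
    have h4 : ((|C| + 1) * r) ^ 2 < ‖toL2 (P φ)‖ ^ 2 :=
      pow_lt_pow_left₀ hφ (by positivity) two_ne_zero
    nlinarith [mul_nonneg (sq_nonneg r) (sq_nonneg |C|), mul_nonneg (sq_nonneg r) (abs_nonneg C)]

theorem toL2_mem_opX_graph (φ : testFunctions) : (toL2 φ, toL2 (Mx φ)) ∈ opX.graph := by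
  rw [opX_graph]
  change ∀ᵐ p : ℝ × ℝ, toL2 (Mx φ) p = (p.1 : ℂ) * toL2 φ p
  filter_upwards [toL2_ae φ, toL2_ae (Mx φ)] with p h1 h2
  rw [h1, h2]
  rfl

theorem exists_norm_Mx_gt (C : ℝ) : ∃ φ : testFunctions,
    C * ‖toL2 (H0expr φ) - Complex.I • toL2 φ‖ < ‖toL2 (Mx φ)‖ := by
  -- If `‖xφ‖ ≤ C * r`, then `‖(H₀ - x)φ‖ ≤ r + ‖φ‖ + ‖xφ‖ ≤ (|C| + 2) * r`, which bounds `‖D_y φ‖²`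
  -- by `(|C| + 2) * r²`.
  obtain ⟨φ, hφ⟩ := exists_norm_Dy_gt (|C| + 2)
  refine ⟨φ, ?_⟩
  by_contra! h
  have h1 := norm_Dy_sq_le φ
  have h2 := norm_toL2_le φ
  have h5 : ‖toL2 (H0expr φ) - toL2 (Mx φ)‖ ≤
      ‖toL2 (H0expr φ) - Complex.I • toL2 φ‖ + ‖toL2 φ‖ + ‖toL2 (Mx φ)‖ := by
    have e : toL2 (H0expr φ) - toL2 (Mx φ) =
      (toL2 (H0expr φ) - Complex.I • toL2 φ) + Complex.I • toL2 φ - toL2 (Mx φ) := by abel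
    have h6 : ‖Complex.I • toL2 φ‖ = ‖toL2 φ‖ := by simp [norm_smul]
    rw [e, ← h6]
    exact (norm_sub_le _ _).trans (add_le_add_left (norm_add_le _ _) _)
  set r := ‖toL2 (H0expr φ) - Complex.I • toL2 φ‖
  have hr : 0 ≤ r := norm_nonneg _
  have h7 : C * r ≤ |C| * r := mul_le_mul_of_nonneg_right (le_abs_self C) hr
  have h3 : ‖toL2 φ‖ * ‖toL2 (H0expr φ) - toL2 (Mx φ)‖ ≤ r * ((|C| + 2) * r) :=
    mul_le_mul h2 (by linarith) (norm_nonneg _) hr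
  have h4 : ((|C| + 2) * r) ^ 2 < ‖toL2 (Dy φ)‖ ^ 2 :=
    pow_lt_pow_left₀ hφ (by positivity) two_ne_zero
  nlinarith [mul_nonneg (sq_nonneg r) (sq_nonneg |C|), mul_nonneg (sq_nonneg r) (abs_nonneg C)]

end

end LandauStark

theorem lemmaA1 :
    IsUnbounded (pmul opX resolventI) ∧
    (∀ k : ℕ, k = 1 ∨ k = 2 → IsUnbounded (pmul (ppow opDxy k) resolventI)) ∧
    (∀ k : ℕ, k = 1 ∨ k = 2 → IsUnbounded (pmul (ppow opDy k) resolventI)) :=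
  ⟨isUnbounded_pmul_resolventI toL2_mem_opX_graph exists_norm_Mx_gt,
    isUnbounded_ppow_resolventI formallySymmetric_Dx_add_My opDxy_graph exists_norm_Dx_add_My_gt,
    isUnbounded_ppow_resolventI formallySymmetric_Dy opDy_graph exists_norm_Dy_gt⟩
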